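/- Theorem 3. A \emph{double chain} of $N=2n$ points is a set $D=U\cup L$ of $2n$ points in the plane, where $U$ (the upper chain) and $L$ (the lower chain) are disjoint and have $n$ points each, such that: the points of $U$ lie on the graph of a strictly convex function and those of $L$ on the graph of a strictly concave function, or vice versa; every line through two points of $U$ leaves all points of $L$ strictly below it; and every line through two points of $L$ leaves all points of $U$ strictly above it. Graphs on a point set are drawn with straight edges, and such a graph is non-crossing if two different edges meet at most in a common endpoint. A \emph{polygonization} of a point set is a non-crossing Hamiltonian cycle on it. A \emph{non-crossing path partition} (ncp partition) of a point set is a non-crossing graph on it each of whose connected components is a path, where an isolated vertex counts as a path of length $0$. An edge of a graph on $D$ is \emph{alternating} if it joins a point of $U$ and a point of $L$. Then the number of polygonizations of a double chain of $N=2n$ points is $O(5.610718614^N)$: there is an absolute constant $C$ such that for every $n$ every double chain of $N=2n$ points admits at most $C\cdot 5.610718614^{N}$ polygonizations. Moreover, for every double chain $D=U\cup L$, deleting the alternating edges of a polygonization of $D$ leaves a pair of ncp partitions, one of $U$ and one of $L$, and the map that sends a polygonization of $D$ to this pair is injective. -/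

import Mathlib

/-- The Euclidean plane in Cartesian coordinates `p = (p.1, p.2)`; the second axis points up. -/
abbrev Plane : Type := ℝ × ℝ

/-- The orientation determinant of `p, q, r`. If `p.1 < q.1`, it is positive exactly when `r` lies
strictly above the line through `p` and `q`, and negative exactly when `r` lies strictly below. -/
def turn (p q r : Plane) : ℝ :=
  (q.1 - p.1) * (r.2 - p.2) - (r.1 - p.1) * (q.2 - p.2)

/-- A finite set of points on the graph of a strictly convex function: the abscissas are distinct
and every three points, read from left to right, make a left turn. -/
def IsConvexChain (S : Finset Plane) : Prop :=
  (∀ p ∈ S, ∀ q ∈ S, p.1 = q.1 → p = q) ∧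
    ∀ p ∈ S, ∀ q ∈ S, ∀ r ∈ S, p.1 < q.1 → q.1 < r.1 → 0 < turn p q r

/-- A finite set of points on the graph of a strictly concave function: the abscissas are distinct
and every three points, read from left to right, make a right turn. -/
def IsConcaveChain (S : Finset Plane) : Prop :=
  (∀ p ∈ S, ∀ q ∈ S, p.1 = q.1 → p = q) ∧
    ∀ p ∈ S, ∀ q ∈ S, ∀ r ∈ S, p.1 < q.1 → q.1 < r.1 → turn p q r < 0

/-- `U ∪ L` is a double chain of `2 * n` points, with upper chain `U` and lower chain `L`. In the
usual picture the chains bulge towards each other (`U` convex, `L` concave); the other way of having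
opposed concavities is admitted as well. -/
structure IsDoubleChain (n : ℕ) (U L : Finset Plane) : Prop where
  card_upper : U.card = n
  card_lower : L.card = n
  disjoint : Disjoint U L
  opposed : (IsConvexChain U ∧ IsConcaveChain L) ∨ (IsConcaveChain U ∧ IsConvexChain L)
  /-- Every line through two points of `U` leaves all points of `L` below. -/
  lower_below : ∀ p ∈ U, ∀ q ∈ U, p.1 < q.1 → ∀ r ∈ L, turn p q r < 0
  /-- Every line through two points of `L` leaves all points of `U` above. -/
  upper_above : ∀ p ∈ L, ∀ q ∈ L, p.1 < q.1 → ∀ r ∈ U, 0 < turn p q r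

/-- A graph on a finite point set, drawn with straight edges, is non-crossing: two different edges
meet at most in a common endpoint. -/
def IsNonCrossing {S : Finset Plane} (G : SimpleGraph S) : Prop :=
  ∀ a b c d : S, G.Adj a b → G.Adj c d → s(a, b) ≠ s(c, d) →
    segment ℝ a.1 b.1 ∩ segment ℝ c.1 d.1 ⊆ ({a.1, b.1} ∩ {c.1, d.1} : Set Plane)

/-- A polygonization of a finite point set: a non-crossing graph that is a Hamiltonian cycle, i.e.
whose edges are exactly those of a closed walk that is a Hamiltonian cycle. -/
def IsPolygonization {S : Finset Plane} (G : SimpleGraph S) : Prop :=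
  IsNonCrossing G ∧
    ∃ (v : S) (w : G.Walk v v), w.IsHamiltonianCycle ∧ ∀ e ∈ G.edgeSet, e ∈ w.edges

/-- A non-crossing path partition of a finite point set: a non-crossing graph each of whose
connected components is a path. A single vertex is the path with one vertex. -/
def IsNCPPartition {S : Finset Plane} (G : SimpleGraph S) : Prop :=
  IsNonCrossing G ∧
    ∀ c : G.ConnectedComponent, ∃ k : ℕ, Nonempty (c.toSimpleGraph ≃g SimpleGraph.pathGraph k)

/-- The part on the upper chain `U` of what remains of a graph on `U ∪ L` after deleting the
alternating edges, i.e. those between `U` and `L`: the graph on `U` formed by the edges with both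
endpoints in `U`. -/
def upperPart {U L : Finset Plane} (G : SimpleGraph ↥(U ∪ L)) : SimpleGraph U :=
  G.comap fun u => ⟨u.1, Finset.mem_union_left L u.2⟩

/-- The same for the lower chain `L`. -/
def lowerPart {U L : Finset Plane} (G : SimpleGraph ↥(U ∪ L)) : SimpleGraph L :=
  G.comap fun l => ⟨l.1, Finset.mem_union_right U l.2⟩

/-! Suppose two polygonizations have the same parts on both chains but differ. Take the leftmost
upper point u at which an alternating edge differs, and then the leftmost lower point l such that ul
lies in exactly one of the two. All degrees are 2, so the polygonization without ul must contain
edges ul' and u'l that the other lacks. These are alternating, with u' to the right of u and l' to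
the right of l, so they cross (`IsDoubleChain.false_of_minimal`). Hence polygonizations inject into
pairs of ncp partitions, and it suffices to bound the ncp partitions of one chain by 5.610718614^n.

Numbering a chain by abscissa gives a graph on `Fin n` without interleaving edges. Its components
form a non-crossing partition, which is determined by recording at the first element of each block
the size of the block (`eq_of_card_fiber_eq`). Adding the shape of each block encodes the graph as a
word of n letters with sizes summing to n (`pathWord_injective`). For k ≥ 2 there are at most
k·2^(k-3) shapes of size k (`two_mul_card_nonCrossingPath_le`): choose a start, then one bit per
inner step, and divide by the two orientations. Weighting each vertex by w bounds the count times
w^n by F(w)^n, where F(w) = 1 + 3w/4 + w/(4(1-2w)^2). The growth rate is F(w)/w at a nearly optimal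
w. -/

/-! ### Separation and non-crossing graphs on a linear order -/

/-- `z` lies strictly between `x` and `y`. -/
def StrictlyBetween {α : Type*} [LinearOrder α] (x y z : α) : Prop :=
  (x < z ∧ z < y) ∨ (y < z ∧ z < x)

/-- Separation of two pairs of points on a circle is symmetric in the pairs, provided that the pairs
share no point. -/
theorem strictlyBetween_iff_swap {α : Type*} [LinearOrder α] {x y s t : α}
    (hxs : x ≠ s) (hxt : x ≠ t) (hys : y ≠ s) (hyt : y ≠ t)
    (h : StrictlyBetween x y s ↔ StrictlyBetween x y t) :
    StrictlyBetween s t x ↔ StrictlyBetween s t y := by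
  unfold StrictlyBetween at *
  grind

/-- If no link of the relation `A` separates a link of the relation `B`, then two points connected
by `A` do not separate two points connected by `B`. -/
theorem strictlyBetween_iff_of_reflTransGen {α : Type*} [LinearOrder α] {A B : α → α → Prop}
    {s t a b : α}
    (hcross : ∀ p q x y, A p q → B x y → (StrictlyBetween x y p ↔ StrictlyBetween x y q))
    (hst : Relation.ReflTransGen A s t) (hab : Relation.ReflTransGen B a b)
    (hdis : ∀ x y, B x y → x ≠ s ∧ x ≠ t ∧ y ≠ s ∧ y ≠ t) :
    StrictlyBetween s t a ↔ StrictlyBetween s t b := by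
  induction hab with
  | refl => rfl
  | @tail x y _ hxy ih =>
    refine ih.trans ?_
    obtain ⟨h1, h2, h3, h4⟩ := hdis x y hxy
    -- After the swap the chord `x y` is fixed, and no link of the chain from `s` to `t` can pass
    -- from one side of it to the other.
    refine strictlyBetween_iff_swap h1 h2 h3 h4 ?_
    clear ih hdis h1 h2 h3 h4
    induction hst with
    | refl => rfl
    | tail _ h ih => exact ih.trans (hcross _ _ _ _ h hxy)

/-- A graph on a linearly ordered set, drawn with chords on points in convex position that are
numbered in this order, has no two crossing edges. -/
def LinNonCrossing {α : Type*} [LinearOrder α] (G : SimpleGraph α) : Prop :=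
  ∀ a b c d : α, a < b → b < c → c < d → G.Adj a c → ¬ G.Adj b d

theorem LinNonCrossing.strictlyBetween_iff {α : Type*} [LinearOrder α] {G : SimpleGraph α}
    (hG : LinNonCrossing G) {p q x y : α} (hpq : G.Adj p q) (hxy : G.Adj x y)
    (h1 : x ≠ p) (h2 : x ≠ q) (h3 : y ≠ p) (h4 : y ≠ q) :
    StrictlyBetween x y p ↔ StrictlyBetween x y q := by
  have aux : ∀ {p q x y : α}, G.Adj p q → G.Adj x y → x < y → x ≠ p → x ≠ q → y ≠ p → y ≠ q →
      x < p → p < y → x < q ∧ q < y := by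
    intro p q x y hpq hxy _ h1 h2 h3 h4 hp hp'
    constructor
    · by_contra hq
      exact hG q x p y (lt_of_le_of_ne (not_lt.1 hq) h2.symm) hp hp' hpq.symm hxy
    · by_contra hq
      exact hG x p y q hp hp' (lt_of_le_of_ne (not_lt.1 hq) h4) hxy hpq
  rcases lt_or_gt_of_ne hxy.ne with h | h
  · have e1 := aux hpq hxy h h1 h2 h3 h4
    have e2 := aux hpq.symm hxy h h2 h1 h4 h3
    unfold StrictlyBetween
    grind
  · have e1 := aux hpq hxy.symm h h3 h4 h1 h2
    have e2 := aux hpq.symm hxy.symm h h4 h3 h2 h1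
    unfold StrictlyBetween
    grind

theorem LinNonCrossing.comap {α β : Type*} [LinearOrder α] [LinearOrder β] {G : SimpleGraph β}
    (hG : LinNonCrossing G) {f : α → β} (hf : StrictMono f) : LinNonCrossing (G.comap f) :=
  fun _ _ _ _ h1 h2 h3 hac hbd => hG _ _ _ _ (hf h1) (hf h2) (hf h3) hac hbd

/-! ### Counting non-crossing Hamiltonian paths in convex position -/

/-- Orders of visit of the points `0, …, k - 1` in convex position along non-crossing Hamiltonian
paths. -/
def NonCrossingOrder (k : ℕ) (v : Equiv.Perm (Fin k)) : Prop :=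
  LinNonCrossing ((SimpleGraph.pathGraph k).comap v.symm)

/-- The position of `x` in the cyclic order of `Fin k` that starts at `s`. -/
def cyclicPos {k : ℕ} (s x : Fin k) : ℕ :=
  if x < s then x.val + k else x.val

theorem cyclicPos_injective {k : ℕ} (s : Fin k) : Function.Injective (cyclicPos s) := by
  intro x y h
  unfold cyclicPos at h
  ext
  have := x.2
  have := y.2
  split_ifs at h <;> omega

/-- In a non-crossing Hamiltonian path, each vertex after the first is the first or the last of the
vertices not yet visited, in the cyclic order starting at the first vertex. -/
theorem NonCrossingOrder.cyclicPos_lt_iff {k : ℕ} {v : Equiv.Perm (Fin k)}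
    (hv : NonCrossingOrder k v) {z i j j' : Fin k} (hz : z.val = 0) (hzi : z < i) (hj : i < j)
    (hj' : i < j') :
    cyclicPos (v z) (v i) < cyclicPos (v z) (v j) ↔
      cyclicPos (v z) (v i) < cyclicPos (v z) (v j') := by
  let A : Fin k → Fin k → Prop := fun p q =>
    ∃ l m : Fin k, p = v l ∧ q = v m ∧ l.val + 1 = m.val ∧ m ≤ i
  let B : Fin k → Fin k → Prop := fun p q =>
    ∃ l m : Fin k, p = v l ∧ q = v m ∧ (l.val + 1 = m.val ∨ m.val + 1 = l.val) ∧ i < l ∧ i < m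
  have hA : Relation.ReflTransGen A (v z) (v i) := by
    have key : ∀ n (h : n < k), n ≤ i.val → Relation.ReflTransGen A (v z) (v ⟨n, h⟩) := by
      intro n
      induction n with
      | zero =>
        intro h _
        have : z = ⟨0, h⟩ := Fin.ext hz
        rw [← this]
      | succ n ih =>
        intro h hn
        exact (ih (by omega) (by omega)).tail ⟨_, _, rfl, rfl, rfl, hn⟩
    exact key i.val i.2 le_rfl
  have hB : ∀ j j' : Fin k, i < j → j ≤ j' → Relation.ReflTransGen B (v j) (v j') := by
    intro j j' hj hjj'
    have key : ∀ n (h : j.val + n < k), Relation.ReflTransGen B (v j) (v ⟨j.val + n, h⟩) := by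
      intro n
      induction n with
      | zero =>
        intro h
        exact Relation.ReflTransGen.refl
      | succ n ih =>
        intro h
        refine (ih (by omega)).tail ⟨_, _, rfl, rfl, Or.inl rfl, ?_, ?_⟩ <;>
          simp only [Fin.lt_def] at * <;> omega
    have e : j' = ⟨j.val + (j'.val - j.val), by omega⟩ := Fin.ext (by simp; omega)
    rw [e]
    exact key _ _
  have hsym : Std.Symm B := ⟨by
    rintro p q ⟨l, m, rfl, rfl, h, h1, h2⟩
    exact ⟨m, l, rfl, rfl, h.symm, h2, h1⟩⟩
  have hBB : Relation.ReflTransGen B (v j) (v j') := by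
    rcases le_total j j' with h | h
    · exact hB j j' hj h
    · exact Relation.ReflTransGen.stdSymm.symm _ _ (hB j' j hj' h)
  -- The path up to `v i` and the path after it are disjoint and do not cross, so the later vertices
  -- all lie on one side of the chord from `v z` to `v i`.
  have key : StrictlyBetween (v z) (v i) (v j) ↔ StrictlyBetween (v z) (v i) (v j') := by
    refine strictlyBetween_iff_of_reflTransGen ?_ hA hBB ?_
    · rintro p q x y ⟨l, m, rfl, rfl, h, h1⟩ ⟨l', m', rfl, rfl, h', h2, h3⟩
      refine hv.strictlyBetween_iff ?_ ?_ ?_ ?_ ?_ ?_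
      · simp [SimpleGraph.pathGraph_adj, h]
      · simpa [SimpleGraph.pathGraph_adj] using h'
      all_goals
        intro e
        have := congrArg Fin.val (v.injective e)
        simp only [Fin.lt_def, Fin.le_def] at *
        omega
    · rintro x y ⟨l', m', rfl, rfl, h', h2, h3⟩
      refine ⟨?_, ?_, ?_, ?_⟩ <;>
      · intro e
        have := congrArg Fin.val (v.injective e)
        simp only [Fin.lt_def, Fin.le_def] at *
        omega
  have hne : ∀ {a b : Fin k}, a < b → (v a).val ≠ (v b).val := fun h e =>
    h.ne (v.injective (Fin.ext e))
  have n1 := hne hzi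
  have n2 := hne hj
  have n3 := hne hj'
  have n4 := hne (hzi.trans hj)
  have n5 := hne (hzi.trans hj')
  have b1 := (v z).2
  have b2 := (v i).2
  have b3 := (v j).2
  have b4 := (v j').2
  unfold cyclicPos
  unfold StrictlyBetween at key
  simp only [Fin.lt_def] at *
  split_ifs <;> omega

open Classical in
/-- The first vertex of a Hamiltonian path, and for each further vertex but the last the information
whether it precedes the vertices not yet visited, in the cyclic order from the first vertex. -/
noncomputable def orderCode {k : ℕ} (hk : 2 ≤ k) (v : Equiv.Perm (Fin k)) :
    Fin k × (Fin (k - 2) → Bool) :=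
  -- For a non-crossing order one later `j` has this property exactly when all do
  -- (`NonCrossingOrder.cyclicPos_lt_iff`). Position 0 is stored separately and the last position
  -- has no choice, which leaves `k - 2` bits.
  (v ⟨0, by omega⟩, fun i => decide (∃ j : Fin k, i.val + 1 < j.val ∧
    cyclicPos (v ⟨0, by omega⟩) (v ⟨i.val + 1, by omega⟩) < cyclicPos (v ⟨0, by omega⟩) (v j)))

theorem orderCode_injOn {k : ℕ} (hk : 2 ≤ k) :
    Set.InjOn (orderCode hk) {v | NonCrossingOrder k v} := by
  intro v hv v' hv' h
  have h0 : v ⟨0, by omega⟩ = v' ⟨0, by omega⟩ := congrArg Prod.fst h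
  have hbits := fun i => congrFun (congrArg Prod.snd h) i
  have key : ∀ m (hm : m < k), v ⟨m, hm⟩ = v' ⟨m, hm⟩ := by
    intro m
    induction m using Nat.strong_induction_on with
    | _ m ih =>
    intro hm
    by_contra hne
    -- At the first disagreement each order visits the other's vertex later. The common bit then
    -- compares the two vertices in opposite directions.
    obtain ⟨j, hj⟩ := v.surjective (v' ⟨m, hm⟩)
    obtain ⟨j', hj'⟩ := v'.surjective (v ⟨m, hm⟩)
    have hmj : m < j.val := by
      by_contra hle
      rcases (not_lt.1 hle).lt_or_eq with hlt | heq
      · have e := v'.injective ((ih j.val hlt j.2).symm.trans hj)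
        have := congrArg Fin.val e
        simp at this
        omega
      · apply hne
        rw [← hj]
        exact congrArg v (Fin.ext heq.symm)
    have hmj' : m < j'.val := by
      by_contra hle
      rcases (not_lt.1 hle).lt_or_eq with hlt | heq
      · have e := v.injective ((ih j'.val hlt j'.2).trans hj')
        have := congrArg Fin.val e
        simp at this
        omega
      · apply hne
        rw [← hj']
        exact (congrArg v' (Fin.ext heq.symm)).symm
    have hm0 : m ≠ 0 := by
      rintro rfl
      exact hne h0
    obtain ⟨i, rfl⟩ := Nat.exists_eq_succ_of_ne_zero hm0
    have hik : i < k - 2 := by omega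
    have hb := hbits ⟨i, hik⟩
    simp only [orderCode, decide_eq_decide] at hb
    rw [← h0] at hb
    have e1 : (∃ l : Fin k, i + 1 < l.val ∧ cyclicPos (v ⟨0, by omega⟩) (v ⟨i + 1, by omega⟩) <
        cyclicPos (v ⟨0, by omega⟩) (v l)) ↔ cyclicPos (v ⟨0, by omega⟩) (v ⟨i + 1, by omega⟩) <
        cyclicPos (v ⟨0, by omega⟩) (v j) := by
      constructor
      · rintro ⟨l, hl, hlt⟩
        exact (hv.cyclicPos_lt_iff (z := ⟨0, by omega⟩) (i := ⟨i + 1, hm⟩) rfl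
          (Fin.lt_def.2 (by simp)) hl hmj).1 hlt
      · exact fun hlt => ⟨j, hmj, hlt⟩
    have e2 : (∃ l : Fin k, i + 1 < l.val ∧ cyclicPos (v ⟨0, by omega⟩) (v' ⟨i + 1, by omega⟩) <
        cyclicPos (v ⟨0, by omega⟩) (v' l)) ↔
        cyclicPos (v ⟨0, by omega⟩) (v' ⟨i + 1, by omega⟩) <
        cyclicPos (v ⟨0, by omega⟩) (v' j') := by
      constructor
      · rintro ⟨l, hl, hlt⟩
        rw [h0] at hlt ⊢
        exact (hv'.cyclicPos_lt_iff (z := ⟨0, by omega⟩) (i := ⟨i + 1, hm⟩) rfl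
          (Fin.lt_def.2 (by simp)) hl hmj').1 hlt
      · exact fun hlt => ⟨j', hmj', hlt⟩
    have hiff := e1.symm.trans (hb.trans e2)
    rw [hj, hj'] at hiff
    rcases lt_or_gt_of_ne fun e => hne (cyclicPos_injective (v ⟨0, by omega⟩) e) with hlt | hlt
    · exact lt_asymm hlt (hiff.1 hlt)
    · exact lt_asymm hlt (hiff.2 hlt)
  exact Equiv.ext fun i => key i.val i.2

/-- The non-crossing Hamiltonian paths on `k` points in convex position. -/
def NonCrossingPath (k : ℕ) : Type :=
  {H : SimpleGraph (Fin k) // LinNonCrossing H ∧ Nonempty (H ≃g SimpleGraph.pathGraph k)}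

noncomputable instance (k : ℕ) : Fintype (NonCrossingPath k) :=
  @Fintype.ofFinite _ (inferInstanceAs (Finite {_H : SimpleGraph (Fin k) // _}))

/-- The vertices of a non-crossing Hamiltonian path, in the order of visit, from the one end or from
the other. -/
noncomputable def NonCrossingPath.order {k : ℕ} (x : NonCrossingPath k × Bool) :
    Equiv.Perm (Fin k) :=
  if x.2 then x.1.2.2.some.symm.toEquiv else Fin.revPerm.trans x.1.2.2.some.symm.toEquiv

theorem pathGraph_adj_rev {k : ℕ} (a b : Fin k) :
    (SimpleGraph.pathGraph k).Adj a.rev b.rev ↔ (SimpleGraph.pathGraph k).Adj a b := by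
  simp only [SimpleGraph.pathGraph_adj, Fin.val_rev]
  omega

theorem NonCrossingPath.comap_order {k : ℕ} (x : NonCrossingPath k × Bool) :
    (SimpleGraph.pathGraph k).comap (NonCrossingPath.order x).symm = x.1.1 := by
  ext a b
  obtain ⟨x, c⟩ := x
  cases c
  · simp only [order, SimpleGraph.comap_adj]
    exact (pathGraph_adj_rev _ _).trans x.2.2.some.map_adj_iff
  · simp only [order, SimpleGraph.comap_adj]
    exact x.2.2.some.map_adj_iff

/-- The order recovers the path, and its two orientations start at different ends as soon as there
are two vertices. This yields the factor 2 in the count. -/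
theorem NonCrossingPath.order_injective {k : ℕ} (hk : 2 ≤ k) :
    Function.Injective (NonCrossingPath.order (k := k)) := by
  rintro ⟨x, c⟩ ⟨y, d⟩ h
  have hxy : x = y := by
    have h1 := NonCrossingPath.comap_order (x, c)
    rw [h] at h1
    exact Subtype.ext (h1.symm.trans (NonCrossingPath.comap_order (y, d)))
  subst hxy
  have h0 := congrArg (fun e => e ⟨0, by omega⟩) h
  have hne : (⟨0, by omega⟩ : Fin k) ≠ Fin.rev ⟨0, by omega⟩ := by
    intro e
    have := congrArg Fin.val e
    simp only [Fin.val_rev] at this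
    omega
  cases c <;> cases d
  · rfl
  · exact absurd (x.2.2.some.symm.injective h0) hne.symm
  · exact absurd (x.2.2.some.symm.injective h0) hne
  · rfl

theorem two_mul_card_nonCrossingPath_le {k : ℕ} (hk : 2 ≤ k) :
    2 * Fintype.card (NonCrossingPath k) ≤ k * 2 ^ (k - 2) := by
  have hinj : Function.Injective fun x : NonCrossingPath k × Bool =>
      orderCode hk (NonCrossingPath.order x) := by
    intro x y h
    refine NonCrossingPath.order_injective hk (orderCode_injOn hk ?_ ?_ h)
    · show LinNonCrossing _
      rw [NonCrossingPath.comap_order]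
      exact x.1.2.1
    · show LinNonCrossing _
      rw [NonCrossingPath.comap_order]
      exact y.1.2.1
  have := Fintype.card_le_of_injective _ hinj
  simpa [mul_comm] using this

theorem card_nonCrossingPath_le_one {k : ℕ} (hk : k < 2) :
    Fintype.card (NonCrossingPath k) ≤ 1 := by
  have : Subsingleton (Fin k) := by
    have : k = 0 ∨ k = 1 := by omega
    rcases this with rfl | rfl <;> infer_instance
  rw [Fintype.card_le_one_iff]
  intro x y
  apply Subtype.ext
  ext a b
  rw [Subsingleton.elim a b]
  simp

/-! ### Encoding non-crossing path forests as words -/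

/-- Each connected component of the graph is a path. -/
def IsPathForest {V : Type*} (G : SimpleGraph V) : Prop :=
  ∀ c : G.ConnectedComponent, ∃ k : ℕ, Nonempty (c.toSimpleGraph ≃g SimpleGraph.pathGraph k)

open Classical in
/-- The vertices reachable from `i`. -/
noncomputable def reachableSet {n : ℕ} (G : SimpleGraph (Fin n)) (i : Fin n) : Finset (Fin n) :=
  Finset.univ.filter fun j => G.Reachable i j

theorem mem_reachableSet {n : ℕ} {G : SimpleGraph (Fin n)} {i j : Fin n} :
    j ∈ reachableSet G i ↔ G.Reachable i j := by
  simp [reachableSet]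

/-- The first vertex of the connected component of `i`. -/
noncomputable def blockMin {n : ℕ} (G : SimpleGraph (Fin n)) (i : Fin n) : Fin n :=
  (reachableSet G i).min' ⟨i, mem_reachableSet.2 (SimpleGraph.Reachable.refl i)⟩

theorem reachable_blockMin {n : ℕ} (G : SimpleGraph (Fin n)) (i : Fin n) :
    G.Reachable i (blockMin G i) :=
  mem_reachableSet.1 (Finset.min'_mem _ _)

theorem blockMin_le {n : ℕ} (G : SimpleGraph (Fin n)) (i : Fin n) : blockMin G i ≤ i :=
  Finset.min'_le _ _ (mem_reachableSet.2 (SimpleGraph.Reachable.refl i))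

theorem blockMin_eq_iff {n : ℕ} {G : SimpleGraph (Fin n)} {i j : Fin n} :
    blockMin G i = blockMin G j ↔ G.Reachable i j := by
  constructor
  · intro h
    exact (reachable_blockMin G i).trans (h ▸ (reachable_blockMin G j).symm)
  · intro h
    have : reachableSet G i = reachableSet G j := by
      ext l
      simp only [mem_reachableSet]
      exact ⟨fun hl => h.symm.trans hl, fun hl => h.trans hl⟩
    simp only [blockMin, this]

theorem blockMin_blockMin {n : ℕ} (G : SimpleGraph (Fin n)) (i : Fin n) :
    blockMin G (blockMin G i) = blockMin G i :=
  blockMin_eq_iff.2 (reachable_blockMin G i).symm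

/-- The connected components of a non-crossing graph form a non-crossing partition. -/
theorem LinNonCrossing.blockMin_eq {n : ℕ} {G : SimpleGraph (Fin n)} (hG : LinNonCrossing G)
    {a b c d : Fin n} (hab : a < b) (hbc : b < c) (hcd : c < d)
    (hac : blockMin G a = blockMin G c) (hbd : blockMin G b = blockMin G d) :
    blockMin G a = blockMin G b := by
  by_contra hne
  have hnr : ¬ G.Reachable a b := fun h => hne (blockMin_eq_iff.2 h)
  rw [blockMin_eq_iff] at hac hbd
  let A : Fin n → Fin n → Prop := fun x y => G.Adj x y ∧ G.Reachable a x
  let B : Fin n → Fin n → Prop := fun x y => G.Adj x y ∧ G.Reachable b x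
  have lift : ∀ s t, G.Reachable s t →
      Relation.ReflTransGen (fun x y => G.Adj x y ∧ G.Reachable s x) s t := by
    intro s t h
    have h' := (SimpleGraph.reachable_iff_reflTransGen _ _).1 h
    induction h' with
    | refl => exact .refl
    | tail h1 h2 ih =>
      have h3 := (SimpleGraph.reachable_iff_reflTransGen _ _).2 h1
      exact (ih h3).tail ⟨h2, h3⟩
  have sep : ∀ {x y}, G.Reachable a x → G.Reachable b y → y ≠ x := by
    rintro x _ hx hy rfl
    exact hnr (hx.trans hy.symm)
  -- Walks from `a` to `c` and from `b` to `d` run in different components, so they share no vertex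
  -- and cannot cross.
  have key : StrictlyBetween a c b ↔ StrictlyBetween a c d := by
    refine strictlyBetween_iff_of_reflTransGen ?_ (lift a c hac) (lift b d hbd) ?_
    · rintro p q x y ⟨h1, h2⟩ ⟨h3, h4⟩
      have h2' := h2.trans h1.reachable
      have h4' := h4.trans h3.reachable
      exact hG.strictlyBetween_iff h1 h3 (sep h2 h4) (sep h2' h4) (sep h2 h4') (sep h2' h4')
    · rintro x y ⟨h3, h4⟩
      have h4' := h4.trans h3.reachable
      exact ⟨sep .rfl h4, sep hac h4, sep .rfl h4', sep hac h4'⟩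
  unfold StrictlyBetween at key
  grind

/-- A non-crossing partition, given by the map to the first element of the block, is determined by
the sizes of its blocks. -/
theorem eq_of_card_fiber_eq {n : ℕ} {f g : Fin n → Fin n}
    (hf : ∀ i, f i ≤ i) (hff : ∀ i, f (f i) = f i)
    (hfc : ∀ a b c d, a < b → b < c → c < d → f a = f c → f b = f d → f a = f b)
    (hg : ∀ i, g i ≤ i) (hgg : ∀ i, g (g i) = g i)
    (hgc : ∀ a b c d, a < b → b < c → c < d → g a = g c → g b = g d → g a = g b)
    (hcard : ∀ j, (Finset.univ.filter fun i => f i = j).card =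
      (Finset.univ.filter fun i => g i = j).card) : f = g := by
  have step : ∀ {f g : Fin n → Fin n}, (∀ i, f i ≤ i) → (∀ i, f (f i) = f i) →
      (∀ a b c d, a < b → b < c → c < d → f a = f c → f b = f d → f a = f b) →
      (∀ i, g i ≤ i) → (∀ i, g (g i) = g i) →
      (∀ j, (Finset.univ.filter fun i => f i = j).card =
        (Finset.univ.filter fun i => g i = j).card) →
      ∀ i, (∀ l < i, f l = g l) → ¬ f i < g i := by
    intro f g hf hff hfc hg hgg hcard i ih hlt
    rcases (hg i).lt_or_eq with hgi | hgi
    -- Below `i` the fibres over `g i` agree, and `i` belongs only to that of `g`. Equal sizes force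
    -- a later `m` into that of `f`, and `f i < g i < i < m` is then a crossing.
    · have hsub : ∃ m, f m = g i ∧ i ≤ m := by
        by_contra hno
        push Not at hno
        have : (Finset.univ.filter fun l => f l = g i) ⊂ Finset.univ.filter fun l => g l = g i := by
          rw [Finset.ssubset_iff_of_subset]
          · refine ⟨i, by simp, ?_⟩
            simpa using hlt.ne
          · intro l hl
            simp only [Finset.mem_filter, Finset.mem_univ, true_and] at hl ⊢
            rw [← ih l (hno l hl), hl]
        exact (Finset.card_lt_card this).ne (hcard _)
      obtain ⟨m, hm, him⟩ := hsub
      have him' : i < m := lt_of_le_of_ne him (by rintro rfl; exact hlt.ne hm)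
      have e : f (g i) = g i := (ih _ hgi).trans (hgg i)
      have := hfc (f i) (g i) i m hlt hgi him' (hff i) (e.trans hm.symm)
      rw [hff, e] at this
      exact hlt.ne this
    · have hne : (Finset.univ.filter fun l => g l = i).Nonempty := ⟨i, by simpa using hgi⟩
      rw [← Finset.card_pos, ← hcard, Finset.card_pos] at hne
      obtain ⟨m, hm⟩ := hne
      simp only [Finset.mem_filter, Finset.mem_univ, true_and] at hm
      have : f i = i := by rw [← hm, hff]
      omega
  have key : ∀ m (hm : m < n), f ⟨m, hm⟩ = g ⟨m, hm⟩ := by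
    intro m
    induction m using Nat.strong_induction_on with
    | _ m ih =>
    intro hm
    have ih' : ∀ l < (⟨m, hm⟩ : Fin n), f l = g l := fun l hl => ih l.val hl l.2
    exact le_antisymm
      (not_lt.1 (step hg hgg hgc hf hff (fun j => (hcard j).symm) _ fun l hl => (ih' l hl).symm))
      (not_lt.1 (step hf hff hfc hg hgg hcard _ ih'))
  exact funext fun i => key i.val i.2

/-- The block whose first element is `j`; it is empty if `j` is not the first element of a block. -/
noncomputable def block {n : ℕ} (G : SimpleGraph (Fin n)) (j : Fin n) : Finset (Fin n) :=
  Finset.univ.filter fun i => blockMin G i = j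

theorem mem_block {n : ℕ} {G : SimpleGraph (Fin n)} {i j : Fin n} :
    i ∈ block G j ↔ blockMin G i = j := by
  simp [block]

theorem card_eq_of_iso_pathGraph {V : Type*} [Fintype V] {G : SimpleGraph V} {k : ℕ}
    (e : G ≃g SimpleGraph.pathGraph k) : Fintype.card V = k := by
  simpa using Fintype.card_congr e.toEquiv

theorem iso_pathGraph_comap_block {n : ℕ} {G : SimpleGraph (Fin n)} (hG : IsPathForest G)
    (j : Fin n) : Nonempty (G.comap ((block G j).orderEmbOfFin rfl) ≃g
      SimpleGraph.pathGraph (block G j).card) := by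
  by_cases hj : (block G j).Nonempty
  · obtain ⟨i, hi⟩ := hj
    have hmem : ∀ x, x ∈ block G j ↔ x ∈ (G.connectedComponentMk i).supp := by
      intro x
      rw [SimpleGraph.ConnectedComponent.mem_supp_iff, SimpleGraph.ConnectedComponent.eq,
        ← blockMin_eq_iff, mem_block, mem_block.1 hi]
    let e : Fin (block G j).card ≃ (G.connectedComponentMk i).supp :=
      ((block G j).orderIsoOfFin rfl).toEquiv.trans (Equiv.subtypeEquivRight hmem)
    let φ : G.comap ((block G j).orderEmbOfFin rfl) ≃g
        (G.connectedComponentMk i).toSimpleGraph := ⟨e, by intro a b; rfl⟩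
    obtain ⟨k, ⟨ψ⟩⟩ := hG (G.connectedComponentMk i)
    have hk := card_eq_of_iso_pathGraph (φ.trans ψ)
    rw [Fintype.card_fin] at hk
    subst hk
    exact ⟨φ.trans ψ⟩
  -- A vertex that starts no block carries the path on no vertices. These letters account for the
  -- constant term of the generating function.
  · have h0 : (block G j).card = 0 := by
      rw [Finset.card_eq_zero]
      exact Finset.not_nonempty_iff_eq_empty.1 hj
    have : IsEmpty (Fin (block G j).card) := by
      rw [h0]
      infer_instance
    exact ⟨⟨Equiv.refl _, by intro a; exact isEmptyElim a⟩⟩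

/-- A size and a non-crossing path on this number of points. -/
abbrev PathLetter (n : ℕ) : Type := Σ k : Fin (n + 1), NonCrossingPath k

/-- The word of a non-crossing graph whose components are paths: the size and the shape of the block
that starts at `j`. -/
noncomputable def pathWord {n : ℕ}
    (G : {G : SimpleGraph (Fin n) // LinNonCrossing G ∧ IsPathForest G}) (j : Fin n) :
    PathLetter n :=
  ⟨⟨(block G.1 j).card, Nat.lt_succ_of_le (card_finset_fin_le _)⟩,
    ⟨G.1.comap ((block G.1 j).orderEmbOfFin rfl),
      G.2.1.comap (OrderEmbedding.strictMono _), iso_pathGraph_comap_block G.2.2 j⟩⟩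

theorem sum_pathWord {n : ℕ}
    (G : {G : SimpleGraph (Fin n) // LinNonCrossing G ∧ IsPathForest G}) :
    ∑ j, ((pathWord G j).1 : ℕ) = n := by
  have := Finset.card_eq_sum_card_fiberwise (f := blockMin G.1) (s := Finset.univ)
    (t := Finset.univ) (by intro _ _; simp)
  rw [Finset.card_univ, Fintype.card_fin] at this
  exact this.symm

theorem pathWord_injective {n : ℕ} : Function.Injective (pathWord (n := n)) := by
  intro G G' h
  have hcard : ∀ j, (block G.1 j).card = (block G'.1 j).card := fun j =>
    congrArg (fun x : PathLetter n => (x.1 : ℕ)) (congrFun h j)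
  have hmin : blockMin G.1 = blockMin G'.1 :=
    eq_of_card_fiber_eq (blockMin_le _) (blockMin_blockMin _)
      (fun a b c d => G.2.1.blockMin_eq) (blockMin_le _) (blockMin_blockMin _)
      (fun a b c d => G'.2.1.blockMin_eq) hcard
  have hblock : ∀ j, block G.1 j = block G'.1 j := fun j => by rw [block, block, hmin]
  -- The type of a shape depends on the size of its block, so shapes are compared by `HEq` until the
  -- blocks are identified.
  have comap_eq : ∀ {F F' : Finset (Fin n)} {H H' : SimpleGraph (Fin n)}, F = F' →
      HEq (H.comap (F.orderEmbOfFin rfl)) (H'.comap (F'.orderEmbOfFin rfl)) →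
      ∀ a ∈ F, ∀ b ∈ F, (H.Adj a b ↔ H'.Adj a b) := by
    rintro F _ H H' rfl he a ha b hb
    have he := eq_of_heq he
    have hr : ∀ a ∈ F, ∃ i, F.orderEmbOfFin rfl i = a := by
      intro a ha
      have : a ∈ Set.range (F.orderEmbOfFin rfl) := by simpa using ha
      exact this
    obtain ⟨i, rfl⟩ := hr a ha
    obtain ⟨l, rfl⟩ := hr b hb
    have := congrArg (fun K : SimpleGraph _ => K.Adj i l) he
    simpa using this
  have hadj : ∀ j, ∀ a ∈ block G.1 j, ∀ b ∈ block G.1 j, (G.1.Adj a b ↔ G'.1.Adj a b) := by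
    intro j
    refine comap_eq (hblock j) ?_
    have hj := congrFun h j
    have aux : ∀ {x y : PathLetter n}, x = y → HEq x.2.1 y.2.1 := by
      rintro x _ rfl
      rfl
    exact aux hj
  apply Subtype.ext
  ext a b
  constructor
  · intro hab
    have := blockMin_eq_iff.2 hab.reachable
    exact (hadj _ a (mem_block.2 rfl) b (mem_block.2 this.symm)).1 hab
  · intro hab
    have := blockMin_eq_iff.2 hab.reachable
    rw [← hmin] at this
    exact (hadj _ a (mem_block.2 rfl) b (mem_block.2 this.symm)).2 hab

/-! ### Generating function and growth rate -/

/-- A bound for the generating function of non-crossing paths. -/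
theorem sum_card_nonCrossingPath_le (n : ℕ) {w : ℝ} (hw0 : 0 ≤ w) (hw : w < 1 / 2) :
    ∑ k : Fin (n + 1), (Fintype.card (NonCrossingPath k) : ℝ) * w ^ (k : ℕ) ≤
      1 + 3 / 4 * w + w / (4 * (1 - 2 * w) ^ 2) := by
  -- The coefficient k·2^(k-3) is 0 at k = 0 and 1/4 at k = 1, where the count is bounded by 1. The
  -- corrections 1 and 3w/4 make up the difference.
  have hterm : ∀ k : ℕ, (Fintype.card (NonCrossingPath k) : ℝ) * w ^ k ≤
      (if k = 0 then 1 else if k = 1 then 3 / 4 * w else 0) + 1 / 8 * (k * (2 * w) ^ k) := by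
    intro k
    match k with
    | 0 =>
      have := card_nonCrossingPath_le_one (k := 0) (by norm_num)
      have h : (Fintype.card (NonCrossingPath 0) : ℝ) ≤ 1 := by exact_mod_cast this
      simpa using h
    | 1 =>
      have := card_nonCrossingPath_le_one (k := 1) (by norm_num)
      have h : (Fintype.card (NonCrossingPath 1) : ℝ) ≤ 1 := by exact_mod_cast this
      simp only [pow_one]
      norm_num
      nlinarith
    | k + 2 =>
      have := two_mul_card_nonCrossingPath_le (k := k + 2) (by omega)
      have h : 2 * (Fintype.card (NonCrossingPath (k + 2)) : ℝ) ≤ ((k + 2 : ℕ) : ℝ) * 2 ^ k := by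
        exact_mod_cast this
      have hwk : 0 ≤ w ^ (k + 2) := by positivity
      have := mul_le_mul_of_nonneg_right h hwk
      have e : ((k + 2 : ℕ) : ℝ) * 2 ^ k * w ^ (k + 2) =
          1 / 4 * (((k + 2 : ℕ) : ℝ) * (2 * w) ^ (k + 2)) := by
        rw [mul_pow, pow_add 2 k 2]
        ring
      simp only [Nat.add_eq_zero_iff, OfNat.ofNat_ne_zero, and_false, if_false]
      rw [if_neg (by omega)]
      linarith
  have hr : ‖2 * w‖ < 1 := by
    rw [Real.norm_of_nonneg (by linarith)]
    linarith
  have hgeo : ∑ k ∈ Finset.range (n + 1), (k : ℝ) * (2 * w) ^ k ≤ 2 * w / (1 - 2 * w) ^ 2 :=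
    sum_le_hasSum _ (fun k _ => by positivity) (hasSum_coe_mul_geometric_of_norm_lt_one hr)
  have hhead : ∑ k ∈ Finset.range (n + 1),
      (if k = 0 then 1 else if k = 1 then 3 / 4 * w else 0 : ℝ) ≤ 1 + 3 / 4 * w := by
    rw [Finset.sum_range_succ']
    have : ∀ k : ℕ, (if k + 1 = 0 then 1 else if k + 1 = 1 then 3 / 4 * w else 0 : ℝ) =
        if k = 0 then 3 / 4 * w else 0 := by
      intro k
      simp
    simp only [this, Finset.sum_ite_eq', if_true]
    split_ifs
    · linarith
    · linarith
  rw [Fin.sum_univ_eq_sum_range fun k => (Fintype.card (NonCrossingPath k) : ℝ) * w ^ k]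
  refine (Finset.sum_le_sum fun k _ => hterm k).trans ?_
  rw [Finset.sum_add_distrib, ← Finset.mul_sum]
  have e : w / (4 * (1 - 2 * w) ^ 2) = 1 / 8 * (2 * w / (1 - 2 * w) ^ 2) := by
    have : (1 - 2 * w) ≠ 0 := by linarith
    field_simp
    ring
  rw [e]
  linarith

/-- The number of non-crossing path partitions of `n` points in convex position, with the growth
rate that the generating function gives at `w`. -/
theorem card_pathForest_mul_pow_le (n : ℕ) {w : ℝ} (hw0 : 0 ≤ w) (hw : w < 1 / 2) :
    ({G : SimpleGraph (Fin n) | LinNonCrossing G ∧ IsPathForest G}.ncard : ℝ) * w ^ n ≤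
      (1 + 3 / 4 * w + w / (4 * (1 - 2 * w) ^ 2)) ^ n := by
  classical
  let X := {G : SimpleGraph (Fin n) // LinNonCrossing G ∧ IsPathForest G}
  have : Fintype X := Fintype.ofFinite X
  have hcard : {G : SimpleGraph (Fin n) | LinNonCrossing G ∧ IsPathForest G}.ncard =
      Fintype.card X := by
    rw [← Nat.card_eq_fintype_card]
    rfl
  calc ({G : SimpleGraph (Fin n) | LinNonCrossing G ∧ IsPathForest G}.ncard : ℝ) * w ^ n
      = ∑ G : X, ∏ j, w ^ ((pathWord G j).1 : ℕ) := by
        simp only [Finset.prod_pow_eq_pow_sum, sum_pathWord]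
        simp [hcard]
    _ = ∑ f ∈ Finset.univ.image (pathWord (n := n)), ∏ j, w ^ ((f j).1 : ℕ) := by
        rw [Finset.sum_image fun _ _ _ _ h => pathWord_injective h]
    -- Admitting all words, whatever their total size, makes the sum factor over the positions.
    _ ≤ ∑ f : Fin n → PathLetter n, ∏ j, w ^ ((f j).1 : ℕ) :=
        Finset.sum_le_sum_of_subset_of_nonneg (Finset.subset_univ _)
          fun _ _ _ => by positivity
    _ = ∏ _j : Fin n, ∑ x : PathLetter n, w ^ (x.1 : ℕ) := by
        rw [Finset.prod_univ_sum, Fintype.piFinset_univ]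
    _ = (∑ k : Fin (n + 1), (Fintype.card (NonCrossingPath k) : ℝ) * w ^ (k : ℕ)) ^ n := by
        rw [Finset.prod_const, Finset.card_univ, Fintype.card_fin, Fintype.sum_sigma]
        simp
    _ ≤ _ := by
        refine pow_le_pow_left₀ ?_ (sum_card_nonCrossingPath_le n hw0 hw) n
        positivity

theorem ncard_pathForest_le (n : ℕ) :
    ({G : SimpleGraph (Fin n) | LinNonCrossing G ∧ IsPathForest G}.ncard : ℝ) ≤
      (5.610718614 : ℝ) ^ n := by
  -- The derivative of 1/w + 3/4 + 1/(4(1-2w)^2) vanishes where w^2 = (1-2w)^3; this `w` is that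
  -- root, rounded.
  have h := card_pathForest_mul_pow_le n (w := 0.2839796) (by norm_num) (by norm_num)
  have h2 : (1 + 3 / 4 * 0.2839796 + 0.2839796 / (4 * (1 - 2 * 0.2839796) ^ 2) : ℝ) ^ n ≤
      (5.610718614 : ℝ) ^ n * 0.2839796 ^ n := by
    rw [← mul_pow]
    exact pow_le_pow_left₀ (by norm_num) (by norm_num) n
  exact le_of_mul_le_mul_right (h.trans h2) (by positivity)

/-! ### From chains in the plane to linear orders -/

theorem turn_rotate (p q r : Plane) : turn q r p = turn p q r := by
  unfold turn
  ring

theorem turn_swap (p q r : Plane) : turn q p r = -turn p q r := by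
  unfold turn
  ring

/-- Two segments that separate each other's endpoints meet. -/
theorem segment_inter_nonempty {a b c d : Plane} (h1 : 0 < turn a c b) (h2 : turn a c d < 0)
    (h3 : turn b d a < 0) (h4 : 0 < turn b d c) :
    (segment ℝ a c ∩ segment ℝ b d).Nonempty := by
  -- Up to sign both sides are the determinant of c - a and d - b, the common denominator of the
  -- coordinates of the meeting point on the two segments.
  have hs : turn b d c - turn b d a = turn a c b - turn a c d := by
    unfold turn
    ring
  have hpos : 0 < turn a c b - turn a c d := by linarith
  have hpt : (turn b d c / (turn a c b - turn a c d)) • a +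
      (-turn b d a / (turn a c b - turn a c d)) • c =
      (-turn a c d / (turn a c b - turn a c d)) • b +
      (turn a c b / (turn a c b - turn a c d)) • d := by
    ext
    · simp only [Prod.fst_add, Prod.smul_fst, smul_eq_mul]
      field_simp
      unfold turn
      ring
    · simp only [Prod.snd_add, Prod.smul_snd, smul_eq_mul]
      field_simp
      unfold turn
      ring
  refine ⟨_, ⟨_, _, div_nonneg h4.le hpos.le, div_nonneg (by linarith) hpos.le, ?_, rfl⟩,
    ⟨_, _, div_nonneg (by linarith) hpos.le, div_nonneg h1.le hpos.le, ?_, hpt.symm⟩⟩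
  · rw [← add_div, div_eq_one_iff_eq hpos.ne']
    linarith
  · rw [← add_div, div_eq_one_iff_eq hpos.ne']
    linarith

theorem IsNonCrossing.not_adj {S : Finset Plane} {G : SimpleGraph S} (hG : IsNonCrossing G)
    {a b c d : S} (hab : a ≠ b) (had : a ≠ d) (hcb : c ≠ b) (hcd : c ≠ d) (hac : G.Adj a c)
    (hmeet : (segment ℝ a.1 c.1 ∩ segment ℝ b.1 d.1).Nonempty) : ¬ G.Adj b d := by
  intro hbd
  obtain ⟨x, hx⟩ := hmeet
  have hne : s(a, c) ≠ s(b, d) := by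
    simp [hab, had]
  have := hG a c b d hac hbd hne hx
  simp only [Set.mem_inter_iff, Set.mem_insert_iff, Set.mem_singleton_iff] at this
  obtain ⟨h1 | h1, h2 | h2⟩ := this
  · exact hab (Subtype.ext (h1.symm.trans h2))
  · exact had (Subtype.ext (h1.symm.trans h2))
  · exact hcb (Subtype.ext (h1.symm.trans h2))
  · exact hcd (Subtype.ext (h1.symm.trans h2))

/-- Interleaving chords of a convex or concave chain meet. -/
theorem segment_inter_nonempty_of_chain {S : Finset Plane}
    (hS : IsConvexChain S ∨ IsConcaveChain S) {a b c d : S} (hab : a.1.1 < b.1.1)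
    (hbc : b.1.1 < c.1.1) (hcd : c.1.1 < d.1.1) :
    (segment ℝ a.1 c.1 ∩ segment ℝ b.1 d.1).Nonempty := by
  rcases hS with ⟨-, h⟩ | ⟨-, h⟩
  · have h1 := h a a.2 b b.2 c c.2 hab hbc
    have h2 := h a a.2 c c.2 d d.2 (hab.trans hbc) hcd
    have h3 := h a a.2 b b.2 d d.2 hab (hbc.trans hcd)
    have h4 := h b b.2 c c.2 d d.2 hbc hcd
    -- On a convex chain `b` lies below the chord `a c` and `d` above it, so the two exchange roles.
    rw [segment_symm ℝ b.1 d.1]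
    refine segment_inter_nonempty h2 ?_ ?_ ?_
    · rw [turn_swap, turn_rotate, turn_rotate]
      linarith
    · rw [turn_swap, turn_rotate]
      linarith
    · rwa [turn_rotate, turn_rotate]
  · have h1 := h a a.2 b b.2 c c.2 hab hbc
    have h2 := h a a.2 c c.2 d d.2 (hab.trans hbc) hcd
    have h3 := h a a.2 b b.2 d d.2 hab (hbc.trans hcd)
    have h4 := h b b.2 c c.2 d d.2 hbc hcd
    refine segment_inter_nonempty ?_ h2 ?_ ?_
    · rw [turn_swap, turn_rotate, turn_rotate]
      linarith
    · rwa [turn_rotate]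
    · rw [turn_swap, turn_rotate, turn_rotate]
      linarith

theorem exists_equiv_fin_abscissa {S : Finset Plane}
    (hS : ∀ p ∈ S, ∀ q ∈ S, p.1 = q.1 → p = q) :
    ∃ e : S ≃ Fin S.card, ∀ i j : Fin S.card, i < j → (e.symm i).1.1 < (e.symm j).1.1 := by
  have hinj : Set.InjOn Prod.fst (S : Set Plane) := fun p hp q hq h => hS p hp q hq h
  have hcard : (S.image Prod.fst).card = S.card := Finset.card_image_of_injOn hinj
  let o := (S.image Prod.fst).orderIsoOfFin hcard
  let f : S → S.image Prod.fst := fun p => ⟨p.1.1, Finset.mem_image_of_mem _ p.2⟩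
  have hf : Function.Bijective f := by
    constructor
    · intro p q h
      exact Subtype.ext (hS p p.2 q q.2 (congrArg Subtype.val h))
    · rintro ⟨x, hx⟩
      obtain ⟨p, hp, rfl⟩ := Finset.mem_image.1 hx
      exact ⟨⟨p, hp⟩, rfl⟩
  refine ⟨(Equiv.ofBijective f hf).trans o.symm.toEquiv, fun i j hij => ?_⟩
  have key : ∀ i, (((Equiv.ofBijective f hf).trans o.symm.toEquiv).symm i).1.1 = (o i).1 := by
    intro i
    exact congrArg Subtype.val ((Equiv.ofBijective f hf).apply_symm_apply (o i))
  rw [key, key]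
  exact o.strictMono hij

theorem IsPathForest.of_iso {V W : Type*} {G : SimpleGraph V} {H : SimpleGraph W} (φ : G ≃g H)
    (hG : IsPathForest G) : IsPathForest H := by
  intro c
  induction c using SimpleGraph.ConnectedComponent.ind with
  | _ v =>
  obtain ⟨k, ⟨ψ⟩⟩ := hG (G.connectedComponentMk (φ.symm v))
  refine ⟨k, ⟨SimpleGraph.Iso.comp ψ ⟨Equiv.subtypeEquiv φ.symm.toEquiv ?_, ?_⟩⟩⟩
  · intro x
    change x ∈ (H.connectedComponentMk v).supp ↔
      φ.symm x ∈ (G.connectedComponentMk (φ.symm v)).supp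
    simp only [SimpleGraph.ConnectedComponent.mem_supp_iff, SimpleGraph.ConnectedComponent.eq]
    exact φ.symm.reachable_iff.symm
  · intro a b
    exact φ.symm.map_adj_iff

/-- Interleaving chords of a chain meet, so relabelling by abscissa maps ncp partitions injectively
to non-crossing path forests on `Fin S.card`. -/
theorem ncard_ncpPartition_le {S : Finset Plane} (hS : IsConvexChain S ∨ IsConcaveChain S) :
    ({G : SimpleGraph S | IsNCPPartition G}.ncard : ℝ) ≤ (5.610718614 : ℝ) ^ S.card := by
  obtain ⟨e, he⟩ := exists_equiv_fin_abscissa (S := S) (by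
    rcases hS with h | h
    · exact h.1
    · exact h.1)
  refine le_trans ?_ (ncard_pathForest_le S.card)
  rw [Nat.cast_le]
  refine Set.ncard_le_ncard_of_injOn (fun G => G.comap e.symm) ?_ ?_ (Set.toFinite _)
  · rintro G ⟨hnc, hpath⟩
    refine ⟨?_, ?_⟩
    · intro a b c d hab hbc hcd hac
      have hne : ∀ {x y : Fin S.card}, x ≠ y → e.symm x ≠ e.symm y :=
        fun h h' => h (e.symm.injective h')
      exact hnc.not_adj (hne hab.ne) (hne (hab.trans (hbc.trans hcd)).ne) (hne hbc.ne')
        (hne hcd.ne) hac (segment_inter_nonempty_of_chain hS (he _ _ hab) (he _ _ hbc)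
          (he _ _ hcd))
    · exact IsPathForest.of_iso (SimpleGraph.Iso.comap e.symm G).symm hpath
  · intro G _ G' _ h
    ext a b
    have := congrArg (fun H : SimpleGraph _ => H.Adj (e a) (e b)) h
    simpa using this

/-! ### Parts of a Hamiltonian cycle are path forests -/

/-- A graph embedded in the path on `ℕ` as an induced subgraph is a disjoint union of paths. -/
theorem isPathForest_of_label {V : Type*} [Finite V] {G : SimpleGraph V} {f : V → ℕ}
    (hf : Function.Injective f) (hadj : ∀ x y, G.Adj x y ↔ f x + 1 = f y ∨ f y + 1 = f x) :
    IsPathForest G := by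
  -- A discrete intermediate value property: labels change by 1 along edges, so each component
  -- occupies an interval of labels.
  have hint : ∀ x y, G.Reachable x y → ∀ t, min (f x) (f y) ≤ t → t ≤ max (f x) (f y) →
      ∃ z, G.Reachable x z ∧ f z = t := by
    intro x y hxy
    have h := (SimpleGraph.reachable_iff_reflTransGen _ _).1 hxy
    clear hxy
    induction h with
    | refl =>
      intro t h1 h2
      exact ⟨x, .rfl, by omega⟩
    | @tail y z h1 h2 ih =>
      intro t ht1 ht2
      have hz := ((SimpleGraph.reachable_iff_reflTransGen _ _).2 h1).trans h2.reachable
      rw [hadj] at h2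
      by_cases ht : t = f z
      · exact ⟨z, hz, ht.symm⟩
      · exact ih t (by omega) (by omega)
  intro c
  induction c using SimpleGraph.ConnectedComponent.ind with
  | _ v =>
  have hsupp : ∀ x, x ∈ (G.connectedComponentMk v).supp ↔ G.Reachable v x := by
    intro x
    rw [SimpleGraph.ConnectedComponent.mem_supp_iff, SimpleGraph.ConnectedComponent.eq]
    exact SimpleGraph.reachable_comm
  obtain ⟨lo, hlo, hmin⟩ := Set.exists_min_image {x | G.Reachable v x} f (Set.toFinite _) ⟨v, .rfl⟩
  obtain ⟨hi, hhi, hmax⟩ := Set.exists_max_image {x | G.Reachable v x} f (Set.toFinite _) ⟨v, .rfl⟩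
  have hlohi := hmin hi hhi
  let g : (G.connectedComponentMk v).supp → Fin (f hi - f lo + 1) := fun x =>
    ⟨f x.1 - f lo, by have := hmax x.1 ((hsupp _).1 x.2); omega⟩
  have hg : Function.Bijective g := by
    constructor
    · intro x y h
      have h1 := hmin x.1 ((hsupp _).1 x.2)
      have h2 := hmin y.1 ((hsupp _).1 y.2)
      have h3 : f x.1 - f lo = f y.1 - f lo := congrArg Fin.val h
      exact Subtype.ext (hf (by omega))
    · rintro ⟨t, ht⟩
      obtain ⟨z, hz, hzt⟩ := hint lo hi (SimpleGraph.Reachable.trans hlo.symm hhi) (f lo + t)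
        (by omega) (by omega)
      exact ⟨⟨z, (hsupp z).2 (SimpleGraph.Reachable.trans hlo hz)⟩, Fin.ext (by simp [g, hzt])⟩
  refine ⟨f hi - f lo + 1, ⟨⟨Equiv.ofBijective g hg, ?_⟩⟩⟩
  intro x y
  have h1 := hmin x.1 ((hsupp _).1 x.2)
  have h2 := hmin y.1 ((hsupp _).1 y.2)
  rw [SimpleGraph.pathGraph_adj]
  refine Iff.trans ?_ (hadj x.1 y.1).symm
  simp only [Equiv.ofBijective_apply, g]
  omega

/-- Removing a vertex from a Hamiltonian cycle leaves a path. -/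
theorem exists_label_of_isPolygonization {S : Finset Plane} {G : SimpleGraph S}
    (hG : IsPolygonization G) (x₀ : S) :
    ∃ f : S → ℕ, (∀ x y, x ≠ x₀ → y ≠ x₀ → f x = f y → x = y) ∧
      ∀ x y, x ≠ x₀ → y ≠ x₀ → (G.Adj x y ↔ f x + 1 = f y ∨ f y + 1 = f x) := by
  obtain ⟨-, v, w₀, hw₀, hedge₀⟩ := hG
  have hmem₀ := hw₀.mem_support x₀
  let w := w₀.rotate x₀ hmem₀
  have hw : w.IsCycle := hw₀.isCycle.rotate hmem₀
  have hmem : ∀ x, x ∈ w.support := by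
    intro x
    rw [SimpleGraph.Walk.mem_support_rotate_iff]
    exact hw₀.mem_support x
  have hedge : ∀ x y, G.Adj x y → ∃ i, s(w.getVert i, w.getVert (i + 1)) = s(x, y) ∧
      i < w.length := by
    intro x y hxy
    rw [← SimpleGraph.Walk.toSubgraph_adj_iff, SimpleGraph.Walk.adj_toSubgraph_iff_mem_edges]
    exact (w₀.rotate_edges x₀ hmem₀).mem_iff.2 (hedge₀ _ hxy)
  have hvert : ∀ x, ∃ i, w.getVert i = x ∧ i ≤ w.length := fun x =>
    SimpleGraph.Walk.mem_support_iff_exists_getVert.1 (hmem x)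
  choose f hf hfle using hvert
  have hpos : ∀ x, x ≠ x₀ → 1 ≤ f x ∧ f x < w.length := by
    intro x hx
    constructor
    · by_contra h
      apply hx
      rw [← hf x, show f x = 0 by omega]
      exact w.getVert_zero
    · refine lt_of_le_of_ne (hfle x) fun h => hx ?_
      rw [← hf x, h]
      exact w.getVert_length
  have hfi : ∀ i, w.getVert i ≠ x₀ → i ≤ w.length → f (w.getVert i) = i := by
    intro i hi hil
    have h1 := hpos _ hi
    have h0 : 1 ≤ i := by
      by_contra h
      apply hi
      rw [show i = 0 by omega]
      exact w.getVert_zero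
    -- The closed walk visits `x₀` at both ends; positions are unique only from 1 on, which is why
    -- `x₀` is left out.
    exact hw.getVert_injOn ⟨h1.1, h1.2.le⟩ ⟨h0, hil⟩ (hf _)
  refine ⟨f, fun x y _ _ h => by rw [← hf x, h, hf y], fun x y hx hy => ⟨fun h => ?_, ?_⟩⟩
  · obtain ⟨i, he, hi⟩ := hedge x y h
    rcases Sym2.eq_iff.1 he with ⟨rfl, rfl⟩ | ⟨rfl, rfl⟩
    · left
      rw [hfi i hx hi.le, hfi (i + 1) hy hi]
    · right
      rw [hfi i hy hi.le, hfi (i + 1) hx hi]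
  · have hsucc : ∀ x y, y ≠ x₀ → f x + 1 = f y → G.Adj x y := by
      intro x y hy h
      have := w.adj_getVert_succ (i := f x) (by have := hpos y hy; omega)
      rwa [h, hf x, hf y] at this
    rintro (h | h)
    · exact hsucc x y hy h
    · exact (hsucc y x hx h).symm

theorem IsPolygonization.ncard_neighborSet {S : Finset Plane} {G : SimpleGraph S}
    (hG : IsPolygonization G) (x : S) : (G.neighborSet x).ncard = 2 := by
  obtain ⟨-, v, w, hw, hedge⟩ := hG
  rw [← hw.isCycle.ncard_neighborSet_toSubgraph_eq_two (hw.mem_support x)]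
  congr 1
  ext y
  simp only [SimpleGraph.mem_neighborSet, SimpleGraph.Subgraph.mem_neighborSet]
  exact ⟨fun h => SimpleGraph.Walk.adj_toSubgraph_iff_mem_edges.2 (hedge _ h), fun h => h.adj_sub⟩

theorem IsPolygonization.nonempty {S : Finset Plane} {G : SimpleGraph S}
    (hG : IsPolygonization G) : S.Nonempty := by
  obtain ⟨-, v, -⟩ := hG
  exact ⟨v, v.2⟩

/-- The part of a polygonization on a proper subset of the points, here the range of `g`. -/
theorem IsPolygonization.isNCPPartition_comap {S T : Finset Plane} {G : SimpleGraph S}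
    (hG : IsPolygonization G) (g : T → S) (hg : ∀ t, (g t).1 = t.1) {x₀ : S} (hx₀ : x₀.1 ∉ T) :
    IsNCPPartition (G.comap g) := by
  have hinj : Function.Injective g := fun a b h => by
    apply Subtype.ext
    rw [← hg, ← hg, h]
  constructor
  · intro a b c d hab hcd hne
    have := hG.1 (g a) (g b) (g c) (g d) hab hcd (by
      intro h
      apply hne
      rw [← Sym2.map_mk, ← Sym2.map_mk] at h
      exact Sym2.map.injective hinj h)
    simpa only [hg] using this
  · obtain ⟨f, hf, hadj⟩ := exists_label_of_isPolygonization hG x₀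
    have hne : ∀ t, g t ≠ x₀ := fun t h => hx₀ (by rw [← h, hg]; exact t.2)
    exact isPathForest_of_label (f := f ∘ g)
      (fun a b h => hinj (hf _ _ (hne a) (hne b) h)) fun a b => hadj _ _ (hne a) (hne b)

/-- Both graphs have degree 2 at `x`, so an edge missing from one is compensated by an edge missing
from the other. -/
theorem IsPolygonization.exists_adj_not_adj {S : Finset Plane} {G G' : SimpleGraph S}
    (hG : IsPolygonization G) (hG' : IsPolygonization G') {x y : S} (h : G.Adj x y)
    (h' : ¬ G'.Adj x y) : ∃ z, G'.Adj x z ∧ ¬ G.Adj x z := by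
  by_contra hno
  push Not at hno
  have hss : G'.neighborSet x ⊂ G.neighborSet x :=
    ⟨fun z hz => hno z hz, fun hle => h' (hle h)⟩
  have := Set.ncard_lt_ncard hss (Set.toFinite _)
  rw [hG.ncard_neighborSet, hG'.ncard_neighborSet] at this
  exact this.ne rfl

/-! ### Injectivity on double chains and the final bound -/

theorem IsDoubleChain.isChain_upper {n : ℕ} {U L : Finset Plane} (h : IsDoubleChain n U L) :
    IsConvexChain U ∨ IsConcaveChain U :=
  h.opposed.imp And.left And.left

theorem IsDoubleChain.isChain_lower {n : ℕ} {U L : Finset Plane} (h : IsDoubleChain n U L) :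
    IsConvexChain L ∨ IsConcaveChain L :=
  h.opposed.symm.imp And.right And.right

theorem abscissa_injOn_of_chain {S : Finset Plane} (h : IsConvexChain S ∨ IsConcaveChain S) :
    ∀ p ∈ S, ∀ q ∈ S, p.1 = q.1 → p = q :=
  h.elim And.left And.left

/-- Alternating edges of a double chain that change the order of their endpoints meet. -/
theorem IsDoubleChain.segment_inter_nonempty {n : ℕ} {U L : Finset Plane}
    (h : IsDoubleChain n U L) {u u' l l' : Plane} (hu : u ∈ U) (hu' : u' ∈ U) (hl : l ∈ L)
    (hl' : l' ∈ L) (huu : u.1 < u'.1) (hll : l.1 < l'.1) :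
    (segment ℝ u l' ∩ segment ℝ u' l).Nonempty := by
  have h1 := h.lower_below u hu u' hu' huu l hl
  have h2 := h.lower_below u hu u' hu' huu l' hl'
  have h3 := h.upper_above l hl l' hl' hll u hu
  have h4 := h.upper_above l hl l' hl' hll u' hu'
  refine _root_.segment_inter_nonempty ?_ ?_ ?_ ?_
  · rw [turn_swap, turn_rotate, turn_rotate]
    linarith
  · rw [turn_swap, turn_rotate]
    linarith
  · rwa [turn_rotate]
  · rwa [turn_rotate, turn_rotate]

/-- Each chain misses a point of the other, and the cycle is cut open at that point. -/
theorem IsDoubleChain.isNCPPartition {n : ℕ} {U L : Finset Plane} (h : IsDoubleChain n U L)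
    {G : SimpleGraph ↥(U ∪ L)} (hG : IsPolygonization G) :
    IsNCPPartition (upperPart G) ∧ IsNCPPartition (lowerPart G) := by
  have hn : 0 < n := by
    obtain ⟨x, hx⟩ := hG.nonempty
    rcases Finset.mem_union.1 hx with hx | hx
    · exact h.card_upper ▸ Finset.card_pos.2 ⟨x, hx⟩
    · exact h.card_lower ▸ Finset.card_pos.2 ⟨x, hx⟩
  obtain ⟨u, hu⟩ := Finset.card_pos.1 (h.card_upper ▸ hn)
  obtain ⟨l, hl⟩ := Finset.card_pos.1 (h.card_lower ▸ hn)
  exact ⟨hG.isNCPPartition_comap _ (fun _ => rfl)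
      (x₀ := ⟨l, Finset.mem_union_right U hl⟩) (Finset.disjoint_right.1 h.disjoint hl),
    hG.isNCPPartition_comap _ (fun _ => rfl)
      (x₀ := ⟨u, Finset.mem_union_left L hu⟩) (Finset.disjoint_left.1 h.disjoint hu)⟩

/-- The leftmost alternating edge that belongs to only one of two polygonizations with the same
parts on both chains yields a crossing. -/
theorem IsDoubleChain.false_of_minimal {n : ℕ} {U L : Finset Plane} (h : IsDoubleChain n U L)
    {G G' : SimpleGraph ↥(U ∪ L)} (hG : IsPolygonization G) (hG' : IsPolygonization G')
    (hU : ∀ x y : ↥(U ∪ L), x.1 ∈ U → y.1 ∈ U → (G.Adj x y ↔ G'.Adj x y))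
    (hL : ∀ x y : ↥(U ∪ L), x.1 ∈ L → y.1 ∈ L → (G.Adj x y ↔ G'.Adj x y))
    {u l : ↥(U ∪ L)} (hu : u.1 ∈ U) (hl : l.1 ∈ L)
    (humin : ∀ x y : ↥(U ∪ L), x.1 ∈ U → y.1 ∈ L → ¬ (G.Adj x y ↔ G'.Adj x y) → u.1.1 ≤ x.1.1)
    (hlmin : ∀ y : ↥(U ∪ L), y.1 ∈ L → ¬ (G.Adj u y ↔ G'.Adj u y) → l.1.1 ≤ y.1.1)
    (hadj : G.Adj u l) (hnadj : ¬ G'.Adj u l) : False := by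
  obtain ⟨l', h1, h2⟩ := hG.exists_adj_not_adj hG' hadj hnadj
  obtain ⟨u', h3, h4⟩ := hG.exists_adj_not_adj hG' hadj.symm fun e => hnadj e.symm
  have hl' : l'.1 ∈ L := by
    rcases Finset.mem_union.1 l'.2 with hx | hx
    · exact absurd ((hU u l' hu hx).2 h1) h2
    · exact hx
  have hu' : u'.1 ∈ U := by
    rcases Finset.mem_union.1 u'.2 with hx | hx
    · exact hx
    · exact absurd ((hL l u' hl hx).2 h3) h4
  have hune : u ≠ u' := by
    rintro rfl
    exact hnadj h3.symm
  have hlne : l ≠ l' := by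
    rintro rfl
    exact hnadj h1
  have huu : u.1.1 < u'.1.1 := by
    refine lt_of_le_of_ne (humin u' l hu' hl fun e => h4 (e.2 h3.symm).symm) fun e => hune ?_
    exact Subtype.ext (abscissa_injOn_of_chain h.isChain_upper _ hu _ hu' e)
  have hll : l.1.1 < l'.1.1 := by
    refine lt_of_le_of_ne (hlmin l' hl' fun e => h2 (e.2 h1)) fun e => hlne ?_
    exact Subtype.ext (abscissa_injOn_of_chain h.isChain_lower _ hl _ hl' e)
  have hUL : ∀ {x y : ↥(U ∪ L)}, x.1 ∈ U → y.1 ∈ L → x ≠ y := by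
    rintro x _ hx hy rfl
    exact Finset.disjoint_left.1 h.disjoint hx hy
  -- Both `u l'` and `u' l` are edges of `G'`, with `u` left of `u'` and `l` left of `l'`, so they
  -- cross.
  exact hG'.1.not_adj hune (hUL hu hl) (hUL hu' hl').symm hlne.symm h1
    (h.segment_inter_nonempty hu hu' hl hl' huu hll) h3.symm

theorem IsDoubleChain.injOn_parts {n : ℕ} {U L : Finset Plane} (h : IsDoubleChain n U L) :
    Set.InjOn (fun G : SimpleGraph ↥(U ∪ L) => (upperPart G, lowerPart G))
      {G | IsPolygonization G} := by
  intro G hG G' hG' heq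
  have hU : ∀ x y : ↥(U ∪ L), x.1 ∈ U → y.1 ∈ U → (G.Adj x y ↔ G'.Adj x y) := by
    intro x y hx hy
    exact iff_of_eq (congrArg (fun P => P.1.Adj ⟨x.1, hx⟩ ⟨y.1, hy⟩) heq)
  have hL : ∀ x y : ↥(U ∪ L), x.1 ∈ L → y.1 ∈ L → (G.Adj x y ↔ G'.Adj x y) := by
    intro x y hx hy
    exact iff_of_eq (congrArg (fun P => P.2.Adj ⟨x.1, hx⟩ ⟨y.1, hy⟩) heq)
  have hUL : ∀ x y : ↥(U ∪ L), x.1 ∈ U → y.1 ∈ L → (G.Adj x y ↔ G'.Adj x y) := by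
    by_contra hno
    push Not at hno
    obtain ⟨x, y, hx, hy, hxy⟩ := hno
    replace hxy : ¬ (G.Adj x y ↔ G'.Adj x y) := by tauto
    obtain ⟨u, ⟨hu, y', hy', huy'⟩, humin⟩ := Set.exists_min_image
      {x : ↥(U ∪ L) | x.1 ∈ U ∧ ∃ y : ↥(U ∪ L), y.1 ∈ L ∧ ¬ (G.Adj x y ↔ G'.Adj x y)}
      (fun x => x.1.1) (Set.toFinite _) ⟨x, hx, y, hy, hxy⟩
    obtain ⟨l, ⟨hl, hul⟩, hlmin⟩ := Set.exists_min_image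
      {y : ↥(U ∪ L) | y.1 ∈ L ∧ ¬ (G.Adj u y ↔ G'.Adj u y)}
      (fun x => x.1.1) (Set.toFinite _) ⟨y', hy', huy'⟩
    -- The lexicographically first differing edge lies in exactly one of the graphs; the two cases
    -- exchange `G` and `G'`.
    by_cases hadj : G.Adj u l
    · exact h.false_of_minimal hG hG' hU hL hu hl (fun x y hx hy hxy => humin x ⟨hx, y, hy, hxy⟩)
        (fun y hy hxy => hlmin y ⟨hy, hxy⟩) hadj (by tauto)
    · exact h.false_of_minimal hG' hG (fun x y hx hy => (hU x y hx hy).symm)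
        (fun x y hx hy => (hL x y hx hy).symm) hu hl
        (fun x y hx hy hxy => humin x ⟨hx, y, hy, fun e => hxy e.symm⟩)
        (fun y hy hxy => hlmin y ⟨hy, fun e => hxy e.symm⟩) (by tauto) hadj
  ext x y
  rcases Finset.mem_union.1 x.2 with hx | hx <;> rcases Finset.mem_union.1 y.2 with hy | hy
  · exact hU x y hx hy
  · exact hUL x y hx hy
  · rw [G.adj_comm, G'.adj_comm]
    exact hUL y x hy hx
  · exact hL x y hx hy

theorem IsDoubleChain.ncard_polygonization_le {n : ℕ} {U L : Finset Plane}
    (h : IsDoubleChain n U L) :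
    ({G : SimpleGraph ↥(U ∪ L) | IsPolygonization G}.ncard : ℝ) ≤
      (5.610718614 : ℝ) ^ (2 * n) := by
  have h1 : {G : SimpleGraph ↥(U ∪ L) | IsPolygonization G}.ncard ≤
      ({G : SimpleGraph U | IsNCPPartition G} ×ˢ
        {G : SimpleGraph L | IsNCPPartition G}).ncard :=
    Set.ncard_le_ncard_of_injOn _ (fun G hG => h.isNCPPartition hG) h.injOn_parts (Set.toFinite _)
  rw [Set.ncard_prod] at h1
  have hu := ncard_ncpPartition_le h.isChain_upper
  have hl := ncard_ncpPartition_le h.isChain_lower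
  rw [h.card_upper] at hu
  rw [h.card_lower] at hl
  calc ({G : SimpleGraph ↥(U ∪ L) | IsPolygonization G}.ncard : ℝ)
      ≤ ({G : SimpleGraph U | IsNCPPartition G}.ncard : ℝ) *
        ({G : SimpleGraph L | IsNCPPartition G}.ncard : ℝ) := by exact_mod_cast h1
    _ ≤ (5.610718614 : ℝ) ^ n * (5.610718614 : ℝ) ^ n :=
        mul_le_mul hu hl (Nat.cast_nonneg _) (by positivity)
    _ = (5.610718614 : ℝ) ^ (2 * n) := by rw [two_mul, pow_add]

theorem theorem3 :
    (∃ C : ℝ, ∀ (n : ℕ) (U L : Finset Plane), IsDoubleChain n U L →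
      ({G : SimpleGraph ↥(U ∪ L) | IsPolygonization G}.ncard : ℝ) ≤
        C * (5.610718614 : ℝ) ^ (2 * n)) ∧
    ∀ (n : ℕ) (U L : Finset Plane), IsDoubleChain n U L →
      (∀ G : SimpleGraph ↥(U ∪ L), IsPolygonization G →
        IsNCPPartition (upperPart G) ∧ IsNCPPartition (lowerPart G)) ∧
      Set.InjOn (fun G : SimpleGraph ↥(U ∪ L) => (upperPart G, lowerPart G))
        {G | IsPolygonization G} := by
  refine ⟨⟨1, fun n U L h => ?_⟩, fun n U L h => ⟨fun G hG => h.isNCPPartition hG, h.injOn_parts⟩⟩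
  rw [one_mul]
  exact h.ncard_polygonization_le
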